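/- There are universal constants $C>0$ and $c\in\mathbb N$ such that the following holds. Let $X$ be a measurable space, $\gamma\ge 1$, $\tau>0$, $k\ge 1$ an integer, and let $\mathcal D$ be a $\gamma$-flat class of probability distributions on $X$, i.e. there is a probability distribution $\bar D$ on $X$ with $D(E)\le\gamma\,\bar D(E)$ for all $D\in\mathcal D$ and all measurable $E\subseteq X$. For a distribution $D$ on $X$, let $D^k[\phi]$ denote the expectation of $\phi(x_1,\dots,x_k)$ for $x_1,\dots,x_k$ drawn independently from $D$, and let $\mathsf{STAT}^{(1)}_D(\tau')$ denote any oracle that answers each (measurable) query $\psi:X\to[-1,1]$ with some value $v$ satisfying $|v-D[\psi]|\le\tau'$; the answer may depend on the earlier queries and answers. Then there is a randomized algorithm that, given any $\delta>0$ and any (measurable) $\phi:X^k\to[-1,1]$, asks at most $$C\cdot F\cdot\max\{1,\log(1/\delta)\}\cdot\bigl(\log(2+F)\bigr)^{c},\qquad F=\frac{\gamma^{k-1}k^3}{\tau^3},$$ queries and, for every (unknown) $D\in\mathcal D$ and every oracle $\mathsf{STAT}^{(1)}_D(\tau/(6k))$ answering its queries, outputs with probability at least $1-\delta$ a value within $\tau$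 of $D^k[\phi]$. In other words, the number of queries is $\tilde O\bigl(\gamma^{k-1}k^3\tau^{-3}\log(1/\delta)\bigr)$. -/

import Mathlib

open MeasureTheory

universe u

namespace SQ

/-- A class `𝒟` of probability distributions on `X` is `γ`-flat if some probability distribution
`Dbar` satisfies `D(E) ≤ γ * Dbar(E)` for all `D ∈ 𝒟` and all measurable `E`. -/
def IsFlat {X : Type u} [MeasurableSpace X] (γ : ℝ) (𝒟 : Set (ProbabilityMeasure X)) : Prop :=
  ∃ Dbar : ProbabilityMeasure X, ∀ D ∈ 𝒟, ∀ E : Set X, MeasurableSet E →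
    (D : Measure X).real E ≤ γ * (Dbar : Measure X).real E

/-- A `k`-ary query function `X^k → [-1, 1]` (measurable, so that its expectation makes sense). -/
structure Query (X : Type u) [MeasurableSpace X] (k : ℕ) where
  toFun : (Fin k → X) → ℝ
  measurable : Measurable toFun
  mem_Icc : ∀ x, toFun x ∈ Set.Icc (-1 : ℝ) 1

/-- The expectation `D^k[φ]` of `φ` on `k` independent samples from `D`. -/
noncomputable def Query.mean {X : Type u} [MeasurableSpace X] {k : ℕ} (φ : Query X k)
    (D : ProbabilityMeasure X) : ℝ :=
  ∫ x, φ.toFun x ∂(Measure.pi fun _ : Fin k => (D : Measure X))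

/-- An oracle for `k`-ary queries. It sees the past queries and its past answers (most recent
first) together with the current query, and it may choose its answer adaptively. -/
abbrev Oracle (X : Type u) [MeasurableSpace X] (k : ℕ) : Type u :=
  List (Query X k × ℝ) → Query X k → ℝ

/-- `O` is a valid `k`-wise statistical query oracle for `D` with tolerance `τ`. -/
def IsSTAT {X : Type u} [MeasurableSpace X] {k : ℕ} (D : ProbabilityMeasure X) (τ : ℝ)
    (O : Oracle X k) : Prop :=
  ∀ h φ, |O h φ - φ.mean D| ≤ τ

/-- Randomized algorithms with real output and access to an oracle for `k`-ary queries, as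
interaction trees: at each step the algorithm stops with an output, draws a random number
(independently of everything before, from a distribution of its choice), or asks a query
and continues according to the answer. -/
inductive Algorithm (X : Type u) [MeasurableSpace X] (k : ℕ) : Type u
  | output (r : ℝ) : Algorithm X k
  | draw (p : PMF ℕ) (next : ℕ → Algorithm X k) : Algorithm X k
  | ask (φ : Query X k) (next : ℝ → Algorithm X k) : Algorithm X k

namespace Algorithm

/-- The distribution of the output when the queries are answered by `O`, started after the
exchange `h` with the oracle. -/
noncomputable def run {X : Type u} [MeasurableSpace X] {k : ℕ} (O : Oracle X k) :
    Algorithm X k → List (Query X k × ℝ) → PMF ℝ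
  | output r, _ => PMF.pure r
  | draw p next, h => p.bind fun i => run O (next i) h
  | ask φ next, h => run O (next (O h φ)) ((φ, O h φ) :: h)

/-- The algorithm asks at most `q` queries, whatever the random draws and the answers are. -/
def AsksAtMost {X : Type u} [MeasurableSpace X] {k : ℕ} : Algorithm X k → ℕ → Prop
  | output _, _ => True
  | draw _ next, q => ∀ i, AsksAtMost (next i) q
  | ask _ _, 0 => False
  | ask _ next, q + 1 => ∀ v, AsksAtMost (next v) q

/-- With probability at least `1 - δ` the output is within `τ` of `a`, when the queries are
answered by `O`. -/
def Estimates {X : Type u} [MeasurableSpace X] {k : ℕ} (A : Algorithm X k) (O : Oracle X k)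
    (a τ δ : ℝ) : Prop :=
  ENNReal.ofReal (1 - δ) ≤ (A.run O []).toOuterMeasure {r | |r - a| ≤ τ}

end Algorithm

end SQ

/-! The proof learns a model of `D` by multiplicative weights, only as well as estimating `φ`
requires. A fine finite partition of `X` replaces `φ` by a function `g` of cells, at a small cost in
mean under every `D` in the class. Let `p` and `q` be the cell weights of `D` and of the dominating
distribution, so `p ≤ γ q`, and let `r` be the current model, initially `q`.

If `r^k[g]` is far from `p^k[g]`, exchanging coordinates one at a time yields a position and a
fixing of the other coordinates for which the resulting unary function separates `p` from `r`. The
fixed coordinates follow `r` before the position and the unknown `p` after it. Sampling the latter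
from `q` instead costs at most a factor `γ^(k-1)`, so random unary restrictions separate with
probability of order `τ / (k γ^(k-1))` (`le_sum_sampleWeight`).

A separating query, detected through the oracle's answer, drives a weight update that lowers the
relative entropy of `p` from `r` by order `(τ/k)^2` (`entropyGain_weightUpdate`). That entropy
starts at most `log γ` (`entropyGain_le`), so about `(k/τ)^2 log γ` updates are possible. A stage
whose samples all fail indicates that `r^k[g]` is accurate, and it is output. Stages times samples
per stage gives the bound (`errorProb_search_le`, `stageCount_mul_stageLength_le`). -/

namespace SQ

/-! ### Approximation by functions of a finite partition -/

/-- A function on `X^k` is a grid function if it factors through a finite measurable partition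
of `X`, applied to each coordinate. -/
def IsGridFunction {X : Type u} [MeasurableSpace X] {k : ℕ} {β : Type*}
    (f : (Fin k → X) → β) : Prop :=
  ∃ (n : ℕ) (π : X → Fin n) (g : (Fin k → Fin n) → β), Measurable π ∧ f = fun x => g (π ∘ x)

namespace IsGridFunction

variable {X : Type u} [MeasurableSpace X] {k : ℕ} {β β' β'' : Type*}

theorem of_finite {ι : Type*} [Fintype ι] [MeasurableSpace ι] [MeasurableSingletonClass ι]
    {π : X → ι} (hπ : Measurable π) (g : (Fin k → ι) → β) :
    IsGridFunction fun x : Fin k → X => g (π ∘ x) := by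
  refine ⟨Fintype.card ι, Fintype.equivFin ι ∘ π, fun y => g ((Fintype.equivFin ι).symm ∘ y),
    (measurable_of_finite _).comp hπ, ?_⟩
  funext x
  congr 1
  funext i
  simp

theorem comp {f : (Fin k → X) → β} (hf : IsGridFunction f) (op : β → β') :
    IsGridFunction fun x => op (f x) := by
  obtain ⟨n, π, g, hπ, rfl⟩ := hf
  exact ⟨n, π, fun y => op (g y), hπ, rfl⟩

theorem comp₂ {f : (Fin k → X) → β} {f' : (Fin k → X) → β'} (hf : IsGridFunction f)
    (hf' : IsGridFunction f') (op : β → β' → β'') :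
    IsGridFunction fun x => op (f x) (f' x) := by
  obtain ⟨n, π, g, hπ, rfl⟩ := hf
  obtain ⟨n', π', g', hπ', rfl⟩ := hf'
  exact of_finite (hπ.prodMk hπ')
    fun y => op (g fun i => (y i).1) (g' fun i => (y i).2)

theorem measurable [MeasurableSpace β] {f : (Fin k → X) → β} (hf : IsGridFunction f) :
    Measurable f := by
  obtain ⟨n, π, g, hπ, rfl⟩ := hf
  exact (measurable_of_finite g).comp
    (measurable_pi_lambda _ fun i => hπ.comp (measurable_pi_apply i))

theorem mem_pi {s : Fin k → Set X} (hs : ∀ i, MeasurableSet (s i)) :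
    IsGridFunction fun x : Fin k → X => x ∈ Set.pi Set.univ s := by
  -- The cell of a point records which of the sets `s i` contain it; coordinate `i` then consults
  -- only its own entry `i`.
  convert! of_finite (π := fun x : X => fun i => x ∈ s i)
    (measurable_pi_lambda _ fun i => measurableSet_setOfPred.1 (hs i)) fun y => ∀ i, y i i using 2
  simp

theorem isSetAlgebra : IsSetAlgebra {s : Set (Fin k → X) | IsGridFunction fun x => x ∈ s} where
  empty_mem := of_finite (π := fun _ => ()) measurable_const fun _ => False
  compl_mem _ hs := hs.comp Not
  union_mem _ _ hs ht := hs.comp₂ ht Or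

theorem generateFrom_eq :
    MeasurableSpace.generateFrom {s : Set (Fin k → X) | IsGridFunction fun x => x ∈ s} =
      MeasurableSpace.pi := by
  apply le_antisymm
  · exact MeasurableSpace.generateFrom_le fun s hs => measurableSet_setOfPred.2 hs.measurable
  · rw [← generateFrom_pi]
    refine MeasurableSpace.generateFrom_mono ?_
    rintro _ ⟨s, hs, rfl⟩
    exact mem_pi fun i => hs i (Set.mem_univ i)

/-- Grid functions are dense in `L¹`. -/
theorem exists_eLpNorm_sub_le (μ : Measure (Fin k → X)) [IsFiniteMeasure μ]
    {f : (Fin k → X) → ℝ} (hf : MemLp f 1 μ) {ε : ENNReal} (hε : ε ≠ 0) :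
    ∃ g, eLpNorm (f - g) 1 μ ≤ ε ∧ IsGridFunction g := by
  classical
  refine hf.induction_dense ENNReal.one_ne_top _ ?_ (fun f g hf hg => hf.comp₂ hg (· + ·))
    (fun f hf => hf.measurable.aestronglyMeasurable) hε
  intro c s hs _ ε hε
  obtain ⟨η, hη, hηε⟩ := exists_eLpNorm_indicator_le (μ := μ) ENNReal.one_ne_top c hε
  -- Grid sets form an algebra generating the product σ-algebra, hence approximate every measurable
  -- set in measure.
  obtain ⟨t, ht, hst⟩ := (Measure.MeasureDense.of_generateFrom_isSetAlgebra_finite μ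
    isSetAlgebra generateFrom_eq.symm).approx s hs (measure_ne_top _ _) η hη
  refine ⟨t.indicator fun _ => c, ?_, ?_⟩
  · rw [eLpNorm_indicator_sub_indicator]
    refine hηε _ ?_
    rw [symmDiff_comm]
    exact hst.le.trans_eq (by simp)
  · convert! ht.comp (fun p : Prop => if p then c else 0) using 2

/-- A bounded measurable function is close in mean to a grid function with the same bound. -/
theorem exists_integral_abs_sub_le (μ : Measure (Fin k → X)) [IsFiniteMeasure μ]
    (φ : Query X k) {ε : ℝ} (hε : 0 < ε) :
    ∃ (n : ℕ) (π : X → Fin n) (g : (Fin k → Fin n) → ℝ), Measurable π ∧ (∀ y, |g y| ≤ 1) ∧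
      ∫ x, |φ.toFun x - g (π ∘ x)| ∂μ ≤ ε := by
  have hφ : MemLp φ.toFun 1 μ := by
    refine MemLp.of_bound φ.measurable.aestronglyMeasurable 1 (.of_forall fun x => ?_)
    exact abs_le.2 (φ.mem_Icc x)
  obtain ⟨f, hf, n, π, g, hπ, rfl⟩ := exists_eLpNorm_sub_le μ hφ (ENNReal.ofReal_pos.2 hε).ne'
  have hgm : Measurable fun x : Fin k → X => g (π ∘ x) := measurable ⟨n, π, g, hπ, rfl⟩
  -- Clipping to `[-1, 1]` cannot increase the distance to `φ`, whose values lie there.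
  refine ⟨n, π, fun y => max (-1) (min 1 (g y)), hπ, fun y => ?_, ?_⟩
  · exact abs_le.2 ⟨le_max_left _ _, max_le (by norm_num) (min_le_left _ _)⟩
  have hsub : Integrable (fun x => φ.toFun x - g (π ∘ x)) μ := by
    rw [← memLp_one_iff_integrable]
    exact ⟨(φ.measurable.sub hgm).aestronglyMeasurable, hf.trans_lt ENNReal.ofReal_lt_top⟩
  have hle : ∀ x, |φ.toFun x - max (-1) (min 1 (g (π ∘ x)))| ≤ |φ.toFun x - g (π ∘ x)| := by
    intro x
    obtain ⟨h1, h2⟩ := φ.mem_Icc x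
    grind
  refine (integral_mono_of_nonneg (.of_forall fun x => abs_nonneg _) hsub.abs
    (.of_forall hle)).trans ?_
  rw [← ENNReal.ofReal_le_ofReal_iff hε.le]
  refine le_trans (le_of_eq ?_) hf
  rw [eLpNorm_one_eq_lintegral_enorm]
  exact ofReal_integral_norm_eq_lintegral_enorm hsub

end IsGridFunction

/-! ### Product measures: domination and cell sums -/

/-- Domination of probability measures tensorizes. -/
theorem pi_le_smul_pi {X : Type u} [MeasurableSpace X] {k : ℕ} {μ ν : Measure X}
    [IsProbabilityMeasure μ] [IsProbabilityMeasure ν] {c : NNReal} (hc : c ≠ 0)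
    (h : μ ≤ c • ν) :
    Measure.pi (fun _ : Fin k => μ) ≤ c ^ k • Measure.pi fun _ : Fin k => ν := by
  -- An inequality on boxes does not extend to all sets in general; here it does because
  -- `OuterMeasure.pi` is the largest outer measure with the prescribed bounds on boxes. Hence the
  -- constant is moved to the left.
  have key : (((c ^ k)⁻¹ • Measure.pi fun _ : Fin k => μ).toOuterMeasure) ≤
      OuterMeasure.pi fun _ : Fin k => ν.toOuterMeasure := by
    rw [OuterMeasure.le_pi]
    intro s _
    change ((c ^ k)⁻¹ • Measure.pi fun _ : Fin k => μ) (Set.pi Set.univ s) ≤ ∏ i, ν (s i)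
    have h2 : ∏ i, μ (s i) ≤ (c : ENNReal) ^ k * ∏ i, ν (s i) := by
      calc ∏ i, μ (s i) ≤ ∏ i, (c : ENNReal) * ν (s i) :=
            Finset.prod_le_prod' fun i _ => h (s i)
        _ = _ := by simp [Finset.prod_mul_distrib]
    rw [Measure.smul_apply, Measure.pi_pi]
    calc (c ^ k)⁻¹ • ∏ i, μ (s i) ≤ (c ^ k)⁻¹ • ((c : ENNReal) ^ k * ∏ i, ν (s i)) := by gcongr
      _ = _ := by
        rw [← ENNReal.coe_pow, ← smul_eq_mul, ENNReal.smul_def, smul_smul,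
          smul_eq_mul, ← ENNReal.coe_mul, inv_mul_cancel₀ (pow_ne_zero _ hc)]
        simp
  have key' : (c ^ k)⁻¹ • Measure.pi (fun _ : Fin k => μ) ≤ Measure.pi fun _ : Fin k => ν := by
    refine Measure.le_iff.2 fun s hs => ?_
    conv_rhs => rw [Measure.pi, toMeasure_apply _ _ hs]
    exact key s
  calc Measure.pi (fun _ : Fin k => μ) = c ^ k • (c ^ k)⁻¹ • Measure.pi fun _ : Fin k => μ := by
        rw [smul_smul, mul_inv_cancel₀ (pow_ne_zero _ hc), one_smul]
    _ ≤ _ := by gcongr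

/-- The mean of a grid function is a finite sum over the cells. -/
theorem integral_comp_cell {X : Type u} [MeasurableSpace X] {k n : ℕ} (μ : Measure X)
    [IsProbabilityMeasure μ] {π : X → Fin n} (hπ : Measurable π) (g : (Fin k → Fin n) → ℝ) :
    ∫ x, g (π ∘ x) ∂(Measure.pi fun _ : Fin k => μ) =
      ∑ y, (∏ i, μ.real (π ⁻¹' {y i})) * g y := by
  have : IsProbabilityMeasure (μ.map π) := Measure.isProbabilityMeasure_map hπ.aemeasurable
  have hmap := Measure.pi_map_pi (μ := fun _ : Fin k => μ) (f := fun _ => π)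
    (fun _ => hπ.aemeasurable)
  have hm : Measurable fun x : Fin k → X => π ∘ x :=
    measurable_pi_lambda _ fun i => hπ.comp (measurable_pi_apply i)
  calc ∫ x, g (π ∘ x) ∂(Measure.pi fun _ : Fin k => μ)
      = ∫ y, g y ∂((Measure.pi fun _ : Fin k => μ).map fun x => π ∘ x) :=
        (integral_map hm.aemeasurable (measurable_of_finite g).aestronglyMeasurable).symm
    _ = ∫ y, g y ∂(Measure.pi fun _ : Fin k => μ.map π) := by rw [← hmap]; rfl
    _ = _ := by
      rw [integral_fintype .of_finite]
      refine Finset.sum_congr rfl fun y _ => ?_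
      rw [smul_eq_mul, measureReal_def, Measure.pi_singleton, ENNReal.toReal_prod]
      congr 1
      refine Finset.prod_congr rfl fun i _ => ?_
      rw [Measure.map_apply hπ (measurableSet_singleton _), measureReal_def]

/-! ### Multiplicative weights and relative entropy -/

section MultiplicativeWeights

variable {ι : Type*} [Fintype ι]

/-- The normalizing constant of the distribution with density proportional to `exp θ` with respect
to `q`. -/
noncomputable def partitionFunction (q θ : ι → ℝ) : ℝ := ∑ a, q a * Real.exp (θ a)

/-- The distribution with density proportional to `exp θ` with respect to `q`. -/
noncomputable def gibbs (q θ : ι → ℝ) (a : ι) : ℝ :=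
  q a * Real.exp (θ a) / partitionFunction q θ

/-- For a distribution `p`, the decrease of the relative entropy of `p` from `q` to `gibbs q θ`. -/
noncomputable def entropyGain (p q θ : ι → ℝ) : ℝ :=
  ∑ a, p a * θ a - Real.log (partitionFunction q θ)

variable {p q θ : ι → ℝ}

theorem partitionFunction_pos (hq : ∀ a, 0 ≤ q a) (hq1 : ∑ a, q a = 1) :
    0 < partitionFunction q θ := by
  have hnn : ∀ a ∈ Finset.univ, 0 ≤ q a * Real.exp (θ a) := fun a _ =>
    mul_nonneg (hq a) (Real.exp_pos _).le
  refine (Finset.sum_nonneg hnn).lt_of_ne fun h => ?_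
  have h0 : ∀ a, q a = 0 := fun a => by
    have := (Finset.sum_eq_zero_iff_of_nonneg hnn).1 h.symm a (Finset.mem_univ a)
    simpa [(Real.exp_pos (θ a)).ne'] using this
  simp [h0] at hq1

theorem gibbs_nonneg (hq : ∀ a, 0 ≤ q a) (a : ι) : 0 ≤ gibbs q θ a :=
  div_nonneg (mul_nonneg (hq a) (Real.exp_pos _).le)
    (Finset.sum_nonneg fun a _ => mul_nonneg (hq a) (Real.exp_pos _).le)

theorem sum_gibbs (hq : ∀ a, 0 ≤ q a) (hq1 : ∑ a, q a = 1) : ∑ a, gibbs q θ a = 1 := by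
  simp only [gibbs]
  rw [← Finset.sum_div]
  exact div_self (partitionFunction_pos hq hq1).ne'

theorem entropyGain_zero (hq1 : ∑ a, q a = 1) : entropyGain p q 0 = 0 := by
  simp [entropyGain, partitionFunction, hq1]

/-- Jensen's inequality for `exp` under `p`, then `p ≤ γ q`. This form of the potential never
divides by weights that may vanish. -/
theorem entropyGain_le (hp : ∀ a, 0 ≤ p a) (hp1 : ∑ a, p a = 1) (hq : ∀ a, 0 ≤ q a)
    (hq1 : ∑ a, q a = 1) {γ : ℝ} (hγ : 0 < γ) (hpq : ∀ a, p a ≤ γ * q a) :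
    entropyGain p q θ ≤ Real.log γ := by
  have hZ := partitionFunction_pos (θ := θ) hq hq1
  have hJ : Real.exp (∑ a, p a * θ a) ≤ ∑ a, p a * Real.exp (θ a) := by
    simpa using convexOn_exp.map_sum_le (t := Finset.univ) (w := p) (p := θ)
      (fun a _ => hp a) hp1 (fun a _ => Set.mem_univ _)
  have hle : ∑ a, p a * Real.exp (θ a) ≤ γ * partitionFunction q θ := by
    rw [partitionFunction, Finset.mul_sum]
    refine Finset.sum_le_sum fun a _ => ?_
    rw [← mul_assoc]
    exact mul_le_mul_of_nonneg_right (hpq a) (Real.exp_pos _).le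
  have := (Real.le_log_iff_exp_le (mul_pos hγ hZ)).2 (hJ.trans hle)
  rw [Real.log_mul hγ.ne' hZ.ne'] at this
  rw [entropyGain]
  linarith

/-- The partition function is multiplied by the `gibbs`-mean of `exp f`, and `exp f ≤ 1 + f + f ^ 2`
for `|f| ≤ 1`. -/
theorem entropyGain_add_ge (hq : ∀ a, 0 ≤ q a) (hq1 : ∑ a, q a = 1) {f : ι → ℝ} {η : ℝ}
    (hη : η ≤ 1) (hf : ∀ a, |f a| ≤ η) :
    entropyGain p q θ + ∑ a, (p a - gibbs q θ a) * f a - η ^ 2 ≤ entropyGain p q (θ + f) := by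
  have hZ := partitionFunction_pos (θ := θ) hq hq1
  have hZ' := partitionFunction_pos (θ := θ + f) hq hq1
  have hratio : partitionFunction q (θ + f) =
      partitionFunction q θ * ∑ a, gibbs q θ a * Real.exp (f a) := by
    rw [Finset.mul_sum, partitionFunction]
    refine Finset.sum_congr rfl fun a _ => ?_
    rw [Pi.add_apply, Real.exp_add, gibbs]
    field_simp
  have hsum : ∑ a, gibbs q θ a * Real.exp (f a) ≤
      Real.exp (∑ a, gibbs q θ a * f a + η ^ 2) := by
    calc ∑ a, gibbs q θ a * Real.exp (f a)
        ≤ ∑ a, gibbs q θ a * (1 + f a + η ^ 2) := by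
          refine Finset.sum_le_sum fun a _ => mul_le_mul_of_nonneg_left ?_ (gibbs_nonneg hq a)
          have h1 := (abs_le.1 (Real.abs_exp_sub_one_sub_id_le ((hf a).trans hη))).2
          have h2 : f a ^ 2 ≤ η ^ 2 := by
            rw [← sq_abs]
            exact pow_le_pow_left₀ (abs_nonneg _) (hf a) 2
          linarith
      _ = (∑ a, gibbs q θ a * f a + η ^ 2) + 1 := by
          simp only [mul_add, Finset.sum_add_distrib, ← Finset.sum_mul, sum_gibbs hq hq1]
          ring
      _ ≤ _ := Real.add_one_le_exp _
  have hlog : Real.log (partitionFunction q (θ + f)) ≤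
      Real.log (partitionFunction q θ) + (∑ a, gibbs q θ a * f a + η ^ 2) := by
    rw [Real.log_le_iff_le_exp hZ', Real.exp_add, Real.exp_log hZ, hratio]
    exact mul_le_mul_of_nonneg_left hsum hZ.le
  simp only [entropyGain, Pi.add_apply, mul_add, sub_mul, Finset.sum_add_distrib,
    Finset.sum_sub_distrib]
  linarith

end MultiplicativeWeights

/-! ### The hybrid argument -/

section Hybrid

/-- The weights that are `r` up to and including position `i`, and `p` afterwards. -/
def hybridWeights {ι : Type*} {k : ℕ} (p r : ι → ℝ) (i l : Fin k) : ι → ℝ := if l ≤ i then r else p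

theorem hybridWeights_nonneg {ι : Type*} {k : ℕ} {p r : ι → ℝ} (hp : ∀ a, 0 ≤ p a) (hr : ∀ a, 0 ≤ r a)
    (i l : Fin k) (a : ι) : 0 ≤ hybridWeights p r i l a := by
  unfold hybridWeights
  split_ifs <;> simp [hp, hr]

/-- The exponent is `k - 1` because position `ω.1` carries `r` on both sides and so costs no factor
`γ`. -/
theorem prod_hybridWeights_le {ι : Type*} {k : ℕ} {p q r : ι → ℝ} (hp : ∀ a, 0 ≤ p a) (hr : ∀ a, 0 ≤ r a)
    {γ : ℝ} (hγ : 1 ≤ γ) (hpq : ∀ a, p a ≤ γ * q a)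
    (ω : Fin k × (Fin k → ι)) :
    ∏ l, hybridWeights p r ω.1 l (ω.2 l) ≤
      γ ^ (k - 1) * ∏ l, hybridWeights q r ω.1 l (ω.2 l) := by
  classical
  have hpow : ∏ l : Fin k, (if l = ω.1 then (1 : ℝ) else γ) = γ ^ (k - 1) := by
    rw [← Finset.mul_prod_erase _ _ (Finset.mem_univ ω.1), if_pos rfl, one_mul,
      Finset.prod_congr rfl fun l hl => if_neg (Finset.ne_of_mem_erase hl)]
    simp
  rw [← hpow, ← Finset.prod_mul_distrib]
  refine Finset.prod_le_prod (fun l _ => hybridWeights_nonneg hp hr _ _ _) fun l _ => ?_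
  unfold hybridWeights
  split_ifs with h1 h2 h2
  · simp
  · exact le_mul_of_one_le_left (hr _) hγ
  · exact absurd h2.le h1
  · exact hpq _

/-- The probability of choosing the position `i` uniformly and `x` with independent coordinates,
distributed according to `r` up to position `i` and according to `q` afterwards. -/
noncomputable def sampleWeight {ι : Type*} {k : ℕ} (q r : ι → ℝ) (ω : Fin k × (Fin k → ι)) : ℝ :=
  (k : ℝ)⁻¹ * ∏ l, hybridWeights q r ω.1 l (ω.2 l)

theorem sampleWeight_nonneg {ι : Type*} {k : ℕ} {q r : ι → ℝ} (hq : ∀ a, 0 ≤ q a) (hr : ∀ a, 0 ≤ r a)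
    (ω : Fin k × (Fin k → ι)) : 0 ≤ sampleWeight q r ω :=
  mul_nonneg (by positivity) (Finset.prod_nonneg fun l _ => hybridWeights_nonneg hq hr _ _ _)

variable {ι : Type*} [Fintype ι] {k : ℕ}

/-- The expectation of `g` under the product of the weights `w`. -/
noncomputable def productMean (w : Fin k → ι → ℝ) (g : (Fin k → ι) → ℝ) : ℝ :=
  ∑ x, (∏ l, w l (x l)) * g x

/-- The unary function obtained from `g` by fixing all coordinates but the `i`-th one. -/
def restrictCoord (g : (Fin k → ι) → ℝ) (ω : Fin k × (Fin k → ι)) (y : ι) : ℝ :=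
  g (Function.update ω.2 ω.1 y)

/-- On the right, `x i` is drawn and then overwritten, so only the total mass of `w i` matters.
Exchanging `x i` with a fresh `y` is an involution of the pairs `(x, y)` that matches the two sides.
-/
theorem productMean_update (w : Fin k → ι → ℝ) (g : (Fin k → ι) → ℝ) (i : Fin k) (h : ι → ℝ)
    (hw : ∑ a, w i a = 1) :
    productMean (Function.update w i h) g =
      ∑ x, (∏ l, w l (x l)) * ∑ y, h y * g (Function.update x i y) := by
  classical
  have hsplit : ∀ (v : Fin k → ι → ℝ) (x : Fin k → ι),
      ∏ l, v l (x l) = v i (x i) * ∏ l ∈ Finset.univ.erase i, v l (x l) := fun v x =>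
    (Finset.mul_prod_erase _ (fun l => v l (x l)) (Finset.mem_univ i)).symm
  have hrest : ∀ x : Fin k → ι, ∏ l ∈ Finset.univ.erase i, Function.update w i h l (x l) =
      ∏ l ∈ Finset.univ.erase i, w l (x l) := fun x =>
    Finset.prod_congr rfl fun l hl => by
      rw [Function.update_of_ne (Finset.ne_of_mem_erase hl)]
  have hrest' : ∀ (x : Fin k → ι) (y : ι),
      ∏ l ∈ Finset.univ.erase i, w l (Function.update x i y l) =
      ∏ l ∈ Finset.univ.erase i, w l (x l) := fun x y =>
    Finset.prod_congr rfl fun l hl => by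
      rw [Function.update_of_ne (Finset.ne_of_mem_erase hl)]
  have hinv : Function.Involutive fun z : (Fin k → ι) × ι =>
      (Function.update z.1 i z.2, z.1 i) := fun z => by simp
  calc productMean (Function.update w i h) g
      = ∑ x, ∑ y, w i y * (h (x i) * (∏ l ∈ Finset.univ.erase i, w l (x l)) * g x) := by
        refine Finset.sum_congr rfl fun x _ => ?_
        rw [← Finset.sum_mul, hw, one_mul, hsplit, hrest, Function.update_self]
    _ = ∑ z : (Fin k → ι) × ι,
          w i z.2 * (h (z.1 i) * (∏ l ∈ Finset.univ.erase i, w l (z.1 l)) * g z.1) :=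
        (Fintype.sum_prod_type' _).symm
    _ = ∑ z : (Fin k → ι) × ι, w i (z.1 i) *
          (h z.2 * (∏ l ∈ Finset.univ.erase i, w l (z.1 l)) *
            g (Function.update z.1 i z.2)) := by
        rw [← Equiv.sum_comp hinv.toPerm]
        refine Finset.sum_congr rfl fun z _ => ?_
        simp only [Function.Involutive.coe_toPerm, Function.update_self, hrest']
    _ = _ := by
        rw [Fintype.sum_prod_type]
        refine Finset.sum_congr rfl fun x _ => ?_
        rw [hsplit, Finset.mul_sum]
        exact Finset.sum_congr rfl fun y _ => by ring

theorem productMean_update_sub (w : Fin k → ι → ℝ) (g : (Fin k → ι) → ℝ) (i : Fin k)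
    (h h' : ι → ℝ) (hw : ∑ a, w i a = 1) :
    productMean (Function.update w i h) g - productMean (Function.update w i h') g =
      ∑ x, (∏ l, w l (x l)) * ∑ y, (h y - h' y) * g (Function.update x i y) := by
  rw [productMean_update w g i h hw, productMean_update w g i h' hw, ← Finset.sum_sub_distrib]
  refine Finset.sum_congr rfl fun x _ => ?_
  rw [← mul_sub, ← Finset.sum_sub_distrib]
  simp only [sub_mul]

/-- Exchanging the distribution `p` for `r` one coordinate at a time. -/
theorem productMean_sub_eq_sum (p r : ι → ℝ) (hr1 : ∑ a, r a = 1) (g : (Fin k → ι) → ℝ) :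
    productMean (fun _ => p) g - productMean (fun _ => r) g =
      ∑ ω : Fin k × (Fin k → ι), (∏ l, hybridWeights p r ω.1 l (ω.2 l)) *
        ∑ y, (p y - r y) * restrictCoord g ω y := by
  classical
  -- `W j` has `r` on the first `j` coordinates. Consecutive hybrids differ only at coordinate `i`,
  -- so both are updates of `hybridWeights p r i` there.
  let W : ℕ → Fin k → ι → ℝ := fun j l => if (l : ℕ) < j then r else p
  have h0 : W 0 = fun _ => p := by simp [W]
  have hk : W k = fun _ => r := by funext l; simp [W]
  have hstep : ∀ i : Fin k, productMean (W i) g - productMean (W (i + 1)) g =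
      ∑ x, (∏ l, hybridWeights p r i l (x l)) * ∑ y, (p y - r y) * restrictCoord g (i, x) y := by
    intro i
    have h1 : W i = Function.update (hybridWeights p r i) i p := by
      funext l
      rcases eq_or_ne l i with rfl | hl
      · simp [W]
      · have : (l : ℕ) < i ↔ l ≤ i := by
          rw [Fin.val_fin_lt]; exact ⟨le_of_lt, fun h => lt_of_le_of_ne h hl⟩
        simp [W, hybridWeights, Function.update_of_ne hl, this]
    have h2 : W (i + 1) = Function.update (hybridWeights p r i) i r := by
      funext l
      rcases eq_or_ne l i with rfl | hl
      · simp [W]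
      · have : (l : ℕ) < i + 1 ↔ l ≤ i := by
          rw [Nat.lt_succ_iff, Fin.val_fin_le]
        simp only [W, hybridWeights, Function.update_of_ne hl, this]
    rw [h1, h2, productMean_update_sub _ _ _ _ _ (by simpa [hybridWeights] using hr1)]
    rfl
  rw [← h0, ← hk, Fintype.sum_prod_type, ← Finset.sum_range_sub' (fun j => productMean (W j) g) k,
    ← Fin.sum_univ_eq_sum_range (fun j => productMean (W j) g - productMean (W (j + 1)) g) k]
  exact Finset.sum_congr rfl fun i _ => hstep i

theorem sum_prod_hybridWeights {p r : ι → ℝ} (hp1 : ∑ a, p a = 1) (hr1 : ∑ a, r a = 1)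
    (i : Fin k) : ∑ x : Fin k → ι, ∏ l, hybridWeights p r i l (x l) = 1 := by
  classical
  rw [← Fintype.prod_sum]
  refine Finset.prod_eq_one fun l _ => ?_
  unfold hybridWeights
  split_ifs <;> assumption

theorem sum_sampleWeight (hk : 0 < k) {q r : ι → ℝ} (hq1 : ∑ a, q a = 1) (hr1 : ∑ a, r a = 1) :
    ∑ ω : Fin k × (Fin k → ι), sampleWeight q r ω = 1 := by
  have : (k : ℝ) ≠ 0 := by positivity
  simp only [sampleWeight]
  rw [← Finset.mul_sum, Fintype.sum_prod_type]
  simp [sum_prod_hybridWeights hq1 hr1, this]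

/-- If `r` is a bad approximation of `p` for `g`, then a sampled unary restriction of `g` is likely
to distinguish `p` from `r`. -/
theorem le_sum_sampleWeight (hk : 0 < k) {p q r : ι → ℝ} (hp : ∀ a, 0 ≤ p a)
    (hp1 : ∑ a, p a = 1) (hr : ∀ a, 0 ≤ r a) (hr1 : ∑ a, r a = 1) {γ : ℝ} (hγ : 1 ≤ γ) (hpq : ∀ a, p a ≤ γ * q a) {g : (Fin k → ι) → ℝ} (hg : ∀ x, |g x| ≤ 1)
    {β : ℝ} (hβ : 0 ≤ β) :
    |productMean (fun _ => r) g - productMean (fun _ => p) g| - k * β ≤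
      2 * k * γ ^ (k - 1) * ∑ ω : Fin k × (Fin k → ι),
        if β < |∑ y, (p y - r y) * restrictCoord g ω y| then sampleWeight q r ω else 0 := by
  have hk0 : (k : ℝ) ≠ 0 := by positivity
  set Δ : Fin k × (Fin k → ι) → ℝ := fun ω => ∑ y, (p y - r y) * restrictCoord g ω y with hΔ
  set V : Fin k × (Fin k → ι) → ℝ := fun ω => ∏ l, hybridWeights p r ω.1 l (ω.2 l) with hV
  have hVnn : ∀ ω, 0 ≤ V ω := fun ω =>
    Finset.prod_nonneg fun l _ => hybridWeights_nonneg hp hr _ _ _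
  have hVsum : ∑ ω, V ω = k := by
    rw [Fintype.sum_prod_type]
    simp [hV, sum_prod_hybridWeights hp1 hr1]
  have hΔ2 : ∀ ω, |Δ ω| ≤ 2 := fun ω => by
    calc |Δ ω| ≤ ∑ y, |(p y - r y) * restrictCoord g ω y| := Finset.abs_sum_le_sum_abs _ _
      _ ≤ ∑ y, (p y + r y) := by
          refine Finset.sum_le_sum fun y _ => ?_
          rw [abs_mul]
          calc |p y - r y| * |restrictCoord g ω y| ≤ |p y - r y| * 1 :=
                mul_le_mul_of_nonneg_left (hg _) (abs_nonneg _)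
            _ ≤ p y + r y := by
                rw [mul_one, abs_le]
                constructor <;> linarith [hp y, hr y]
      _ = 2 := by rw [Finset.sum_add_distrib, hp1, hr1]; norm_num
  have hVle : ∀ ω, V ω ≤ k * γ ^ (k - 1) * sampleWeight q r ω := fun ω => by
    have := prod_hybridWeights_le hp hr hγ hpq ω
    rw [sampleWeight]
    calc V ω ≤ _ := this
      _ = _ := by field_simp
  -- Split at the threshold: small gaps contribute at most `k * β` in total, since `V` has mass `k`;
  -- for large ones the trivial bound `2` and the domination of `V` by `sampleWeight` suffice.
  have hterm : ∀ ω, V ω * |Δ ω| ≤ V ω * β +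
      2 * k * γ ^ (k - 1) * (if β < |Δ ω| then sampleWeight q r ω else 0) := fun ω => by
    split_ifs with h
    · have h1 : V ω * |Δ ω| ≤ V ω * 2 := mul_le_mul_of_nonneg_left (hΔ2 ω) (hVnn ω)
      have h2 : 0 ≤ V ω * β := mul_nonneg (hVnn ω) hβ
      linarith [hVle ω]
    · rw [mul_zero, add_zero]
      exact mul_le_mul_of_nonneg_left (not_lt.1 h) (hVnn ω)
  have hmain : |productMean (fun _ => r) g - productMean (fun _ => p) g| ≤ ∑ ω, V ω * |Δ ω| := by
    rw [abs_sub_comm, productMean_sub_eq_sum p r hr1 g]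
    refine (Finset.abs_sum_le_sum_abs _ _).trans (Finset.sum_le_sum fun ω _ => ?_)
    rw [abs_mul, abs_of_nonneg (hVnn ω)]
  have := hmain.trans (Finset.sum_le_sum fun ω _ => hterm ω)
  rw [Finset.sum_add_distrib, ← Finset.sum_mul, hVsum, ← Finset.mul_sum] at this
  linarith

end Hybrid

/-! ### Error probabilities and a single search stage -/

namespace Algorithm

variable {X : Type u} [MeasurableSpace X] {k : ℕ}

/-- Draw from a distribution on a countable type. -/
noncomputable def drawFrom {α : Type*} [Countable α] [Nonempty α] (P : PMF α)
    (next : α → Algorithm X k) : Algorithm X k :=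
  draw (P.map (exists_injective_nat α).choose) fun n =>
    next (Function.invFun (exists_injective_nat α).choose n)

theorem run_drawFrom {α : Type*} [Countable α] [Nonempty α] (P : PMF α)
    (next : α → Algorithm X k) (O : Oracle X k) (h : List (Query X k × ℝ)) :
    (drawFrom P next).run O h = P.bind fun a => (next a).run O h := by
  rw [drawFrom, run, PMF.bind_map]
  congr 1
  funext a
  simp [Function.leftInverse_invFun (exists_injective_nat α).choose_spec a]

theorem AsksAtMost.drawFrom {α : Type*} [Countable α] [Nonempty α] {P : PMF α}
    {next : α → Algorithm X k} {m : ℕ} (h : ∀ a, (next a).AsksAtMost m) :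
    (drawFrom P next).AsksAtMost m := fun _ => h _

/-- The probability that the output is not within `ε` of `a`, after the exchange `h`. -/
noncomputable def errorProb (A : Algorithm X k) (O : Oracle X k) (h : List (Query X k × ℝ))
    (a ε : ℝ) : ENNReal :=
  (A.run O h).toOuterMeasure {r | ε < |r - a|}

variable {O : Oracle X k} {h : List (Query X k × ℝ)} {a ε : ℝ}

theorem errorProb_drawFrom {α : Type*} [Countable α] [Nonempty α] (P : PMF α)
    (next : α → Algorithm X k) :
    (drawFrom P next).errorProb O h a ε = ∑' ω, P ω * (next ω).errorProb O h a ε := by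
  rw [errorProb, run_drawFrom, PMF.toOuterMeasure_bind_apply]
  rfl

theorem errorProb_ask (φ : Query X k) (next : ℝ → Algorithm X k) :
    (ask φ next).errorProb O h a ε =
      (next (O h φ)).errorProb O ((φ, O h φ) :: h) a ε := rfl

theorem errorProb_output {r : ℝ} (hr : |r - a| ≤ ε) : (output r).errorProb O h a ε = 0 := by
  rw [errorProb, run, PMF.toOuterMeasure_pure_apply, if_neg]
  simpa using hr

theorem errorProb_le_one (A : Algorithm X k) : A.errorProb O h a ε ≤ 1 := by
  rw [errorProb, PMF.toOuterMeasure_apply, ← PMF.tsum_coe (A.run O h)]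
  exact ENNReal.tsum_le_tsum fun r => Set.indicator_le_self _ _ _

theorem estimates_of_errorProb_le {A : Algorithm X k} {δ : ℝ} (hδ : 0 ≤ δ)
    (hA : A.errorProb O [] a ε ≤ ENNReal.ofReal δ) : A.Estimates O a ε δ := by
  have htot : (A.run O []).toOuterMeasure {r | |r - a| ≤ ε} + A.errorProb O [] a ε = 1 := by
    have hc : {r : ℝ | ε < |r - a|} = {r | |r - a| ≤ ε}ᶜ := by ext; simp
    rw [errorProb, hc, PMF.toOuterMeasure_apply, PMF.toOuterMeasure_apply, ← ENNReal.tsum_add,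
      ← PMF.tsum_coe (A.run O [])]
    exact tsum_congr fun r => Set.indicator_self_add_compl_apply _ _ _
  rw [Estimates, ENNReal.ofReal_sub _ hδ, ENNReal.ofReal_one, ← htot]
  exact tsub_le_iff_right.2 (by gcongr)

section Stage

variable {Ω : Type*} [Countable Ω] [Nonempty Ω]

open Classical in
/-- Up to `t` times, draw a query and ask it; when an answer passes the test, go on with `next`.
If that never happens, output `r`. -/
noncomputable def searchStage (P : PMF Ω) (Q : Ω → Query X k) (test : Ω → ℝ → Prop)
    (next : Ω → ℝ → Algorithm X k) (r : ℝ) : ℕ → Algorithm X k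
  | 0 => output r
  | t + 1 => drawFrom P fun ω => ask (Q ω) fun v =>
      if test ω v then next ω v else searchStage P Q test next r t

variable {P : PMF Ω} {Q : Ω → Query X k} {test : Ω → ℝ → Prop} {next : Ω → ℝ → Algorithm X k}
  {r : ℝ}

theorem asksAtMost_output (m : ℕ) : (output r : Algorithm X k).AsksAtMost m := by
  cases m <;> trivial

/-- The budget ranges over all larger `m'` because a stage may succeed early and leave queries
unused. -/
theorem asksAtMost_searchStage {m : ℕ} (hnext : ∀ ω v m', m ≤ m' → (next ω v).AsksAtMost m')
    (t : ℕ) : ∀ m', m + t ≤ m' → (searchStage P Q test next r t).AsksAtMost m' := by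
  induction t with
  | zero => exact fun m' _ => asksAtMost_output m'
  | succ t ih =>
    intro m' hm'
    obtain ⟨l, rfl⟩ : ∃ l, m' = l + 1 := ⟨m' - 1, by omega⟩
    refine AsksAtMost.drawFrom fun ω v => ?_
    beta_reduce
    split_ifs
    · exact hnext ω v l (by omega)
    · exact ih l (by omega)

/-- When `r` is accurate, falling through is harmless, and only the continuation can err. -/
theorem errorProb_searchStage_le_of_good {β : ENNReal}
    (hnext : ∀ ω h h', test ω (O h (Q ω)) → (next ω (O h (Q ω))).errorProb O h' a ε ≤ β)
    (hr : |r - a| ≤ ε) (t : ℕ) :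
    ∀ h, (searchStage P Q test next r t).errorProb O h a ε ≤ β := by
  induction t with
  | zero => intro h; rw [searchStage, errorProb_output hr]; exact zero_le
  | succ t ih =>
    intro h
    rw [searchStage, errorProb_drawFrom]
    calc _ ≤ ∑' ω, P ω * β := by
          refine ENNReal.tsum_le_tsum fun ω => mul_le_mul_right ?_ _
          rw [errorProb_ask]
          split_ifs with ht
          · exact hnext _ _ _ ht
          · exact ih _
      _ = β := by rw [ENNReal.tsum_mul_right, PMF.tsum_coe, one_mul]

/-- A stage falls through only if all `t` independent draws miss `B`. Draws in `B` must pass after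
every history `h`, since the oracle is adaptive; a draw outside `B` that passes anyway is covered by
`β`. -/
theorem errorProb_searchStage_le_of_likely {β σ : ENNReal} {B : Set Ω}
    (hnext : ∀ ω h h', test ω (O h (Q ω)) → (next ω (O h (Q ω))).errorProb O h' a ε ≤ β)
    (hB : ∀ ω ∈ B, ∀ h, test ω (O h (Q ω))) (hP : P.toOuterMeasure Bᶜ ≤ σ) (t : ℕ) :
    ∀ h, (searchStage P Q test next r t).errorProb O h a ε ≤ σ ^ t + β := by
  induction t with
  | zero => intro h; rw [pow_zero]; exact (errorProb_le_one _).trans le_self_add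
  | succ t ih =>
    intro h
    rw [searchStage, errorProb_drawFrom]
    calc _ ≤ ∑' ω, (Bᶜ.indicator P ω * σ ^ t + P ω * β) := by
          refine ENNReal.tsum_le_tsum fun ω => ?_
          rw [errorProb_ask]
          by_cases hω : ω ∈ B
          · rw [if_pos (hB ω hω h), Set.indicator_of_notMem (by simpa using hω), zero_mul,
              zero_add]
            exact mul_le_mul_right (hnext _ _ _ (hB ω hω h)) _
          · rw [Set.indicator_of_mem (by simpa using hω), ← mul_add]
            refine mul_le_mul_right ?_ _
            split_ifs with ht
            · exact (hnext _ _ _ ht).trans le_add_self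
            · exact ih _
      _ = P.toOuterMeasure Bᶜ * σ ^ t + β := by
          rw [ENNReal.tsum_add, ENNReal.tsum_mul_right, ENNReal.tsum_mul_right, PMF.tsum_coe,
            one_mul, PMF.toOuterMeasure_apply]
      _ ≤ σ ^ (t + 1) + β := by
          rw [pow_succ']
          gcongr

end Stage

end Algorithm

/-! ### The full search and its potential argument -/

section Search

variable {ι : Type} [Fintype ι] {k : ℕ}

/-- The distribution `sampleWeight q r` as a probability mass function. -/
noncomputable def samplePMF (hk : 0 < k) {q r : ι → ℝ} (hq : ∀ a, 0 ≤ q a) (hq1 : ∑ a, q a = 1)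
    (hr : ∀ a, 0 ≤ r a) (hr1 : ∑ a, r a = 1) : PMF (Fin k × (Fin k → ι)) :=
  PMF.ofFintype (fun ω => ENNReal.ofReal (sampleWeight q r ω)) (by
    rw [← ENNReal.ofReal_sum_of_nonneg fun ω _ => sampleWeight_nonneg hq hr ω,
      sum_sampleWeight hk hq1 hr1, ENNReal.ofReal_one])

open Classical in
theorem samplePMF_compl_le (hk : 0 < k) {q r : ι → ℝ} (hq : ∀ a, 0 ≤ q a) (hq1 : ∑ a, q a = 1)
    (hr : ∀ a, 0 ≤ r a) (hr1 : ∑ a, r a = 1) (B : Set (Fin k × (Fin k → ι))) {ρ : ℝ}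
    (hB : ρ ≤ ∑ ω, if ω ∈ B then sampleWeight q r ω else 0) :
    (samplePMF hk hq hq1 hr hr1).toOuterMeasure Bᶜ ≤ ENNReal.ofReal (1 - ρ) := by
  have hsum : ∑ ω, (if ω ∈ B then sampleWeight q r ω else 0) +
      ∑ ω, (if ω ∈ B then 0 else sampleWeight q r ω) = 1 := by
    rw [← Finset.sum_add_distrib, ← sum_sampleWeight hk hq1 hr1]
    exact Finset.sum_congr rfl fun ω _ => by split_ifs <;> simp
  calc (samplePMF hk hq hq1 hr hr1).toOuterMeasure Bᶜ
      = ∑ ω, ENNReal.ofReal (if ω ∈ B then 0 else sampleWeight q r ω) := by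
        rw [PMF.toOuterMeasure_apply, tsum_fintype]
        refine Finset.sum_congr rfl fun ω _ => ?_
        by_cases hω : ω ∈ B <;> simp [hω, samplePMF]
    _ = ENNReal.ofReal (∑ ω, if ω ∈ B then 0 else sampleWeight q r ω) := by
        refine (ENNReal.ofReal_sum_of_nonneg fun ω _ => ?_).symm
        split_ifs
        exacts [le_rfl, sampleWeight_nonneg hq hr ω]
    _ ≤ _ := ENNReal.ofReal_le_ofReal (by linarith)

/-- Multiplicative weights update: raise or lower the weights along `f` with rate `α / 2`, so that
the mean of `f` moves towards the value `v`. -/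
noncomputable def weightUpdate (q : ι → ℝ) (α : ℝ) (θ f : ι → ℝ) (v : ℝ) : ι → ℝ :=
  θ + fun a => (if ∑ b, gibbs q θ b * f b < v then α / 2 else -(α / 2)) * f a

/-- With answers accurate to `α`, a passed test leaves a true gap above `α` whose sign is visible
from `v`. At rate `α / 2` the linear gain is at least `α ^ 2 / 2` and the quadratic loss at most `α
^ 2 / 4`. -/
theorem entropyGain_weightUpdate {p q θ f : ι → ℝ} (hq : ∀ a, 0 ≤ q a) (hq1 : ∑ a, q a = 1)
    (hf : ∀ a, |f a| ≤ 1) {α v : ℝ} (hα : 0 ≤ α) (hα1 : α ≤ 1)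
    (hv : |v - ∑ a, p a * f a| ≤ α) (htest : 2 * α < |v - ∑ a, gibbs q θ a * f a|) :
    entropyGain p q θ + α ^ 2 / 4 ≤ entropyGain p q (weightUpdate q α θ f v) := by
  have hstep : ∀ a, |(if ∑ b, gibbs q θ b * f b < v then α / 2 else -(α / 2)) * f a| ≤ α / 2 := by
    intro a
    have h2 : |if ∑ b, gibbs q θ b * f b < v then α / 2 else -(α / 2)| = α / 2 := by
      split_ifs
      · exact abs_of_nonneg (by linarith)
      · rw [abs_neg]; exact abs_of_nonneg (by linarith)
    rw [abs_mul, h2]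
    exact mul_le_of_le_one_right (by linarith) (hf a)
  have hgain := entropyGain_add_ge (p := p) (θ := θ) hq hq1 (by linarith) hstep
  have hlin : α * (α / 2) ≤ ∑ a, (p a - gibbs q θ a) *
      ((if ∑ b, gibbs q θ b * f b < v then α / 2 else -(α / 2)) * f a) := by
    have heq : ∀ c : ℝ, ∑ a, (p a - gibbs q θ a) * (c * f a) =
        c * (∑ a, p a * f a - ∑ a, gibbs q θ a * f a) := fun c => by
      rw [← Finset.sum_sub_distrib, Finset.mul_sum]
      exact Finset.sum_congr rfl fun a _ => by ring
    rw [heq]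
    obtain ⟨hv1, hv2⟩ := abs_le.1 hv
    split_ifs with hlt
    · rw [abs_of_pos (by linarith)] at htest
      nlinarith
    · rw [abs_of_nonpos (by linarith)] at htest
      nlinarith
  rw [weightUpdate]
  nlinarith

/-- Multiplicative weights search for an approximation `gibbs q θ` of the unknown distribution that
is not distinguished from it by the unary restrictions of `g`. There are `u` stages, each with at
most `t` queries. -/
noncomputable def search {X : Type u} [MeasurableSpace X] [Nonempty (Fin k × (Fin k → ι))]
    (hk : 0 < k) {q : ι → ℝ} (hq : ∀ a, 0 ≤ q a) (hq1 : ∑ a, q a = 1) (g : (Fin k → ι) → ℝ)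
    (Q : Fin k × (Fin k → ι) → Query X 1) (α : ℝ) (t : ℕ) : ℕ → (ι → ℝ) → Algorithm X 1
  | 0, _ => .output 0
  | u + 1, θ => Algorithm.searchStage
      (samplePMF hk hq hq1 (gibbs_nonneg (θ := θ) hq) (sum_gibbs hq hq1)) Q
      (fun ω v => 2 * α < |v - ∑ a, gibbs q θ a * restrictCoord g ω a|)
      (fun ω v => search hk hq hq1 g Q α t u (weightUpdate q α θ (restrictCoord g ω) v))
      (productMean (fun _ => gibbs q θ) g) t

variable {X : Type u} [MeasurableSpace X] [Nonempty (Fin k × (Fin k → ι))] {hk : 0 < k}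
  {p q : ι → ℝ} {hq : ∀ a, 0 ≤ q a} {hq1 : ∑ a, q a = 1} {g : (Fin k → ι) → ℝ}
  {Q : Fin k × (Fin k → ι) → Query X 1} {α : ℝ} {t : ℕ}

theorem asksAtMost_search (u : ℕ) :
    ∀ θ m, u * t ≤ m → (search hk hq hq1 g Q α t u θ).AsksAtMost m := by
  induction u with
  | zero => exact fun θ m _ => Algorithm.asksAtMost_output m
  | succ u ih =>
    intro θ m hm
    exact Algorithm.asksAtMost_searchStage (m := u * t) (fun ω v m' hm' => ih _ m' hm') t m
      (by rwa [Nat.succ_mul] at hm)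

/-- The hypothesis on `Real.log γ` is the invariant: each passed test raises the gain by `α ^ 2 / 4`
and uses up one stage. The error is a union bound over stages that fall through with a bad model. -/
theorem errorProb_search_le {D : ProbabilityMeasure X} {O : Oracle X 1} (hO : IsSTAT D α O)
    (hQ : ∀ ω, (Q ω).mean D = ∑ a, p a * restrictCoord g ω a) (hp : ∀ a, 0 ≤ p a)
    (hp1 : ∑ a, p a = 1) {γ : ℝ} (hγ : 1 ≤ γ) (hpq : ∀ a, p a ≤ γ * q a) (hg : ∀ x, |g x| ≤ 1)
    (hα : 0 ≤ α) (hα1 : α ≤ 1) {ε ρ : ℝ}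
    (hρ : ρ * (2 * k * γ ^ (k - 1)) ≤ ε - k * (3 * α)) (u : ℕ) :
    ∀ θ h, Real.log γ < entropyGain p q θ + u * (α ^ 2 / 4) →
      (search hk hq hq1 g Q α t u θ).errorProb O h (productMean (fun _ => p) g) ε ≤
        u * ENNReal.ofReal (1 - ρ) ^ t := by
  classical
  have hmean : ∀ ω h, |O h (Q ω) - ∑ a, p a * restrictCoord g ω a| ≤ α := fun ω h => by
    rw [← hQ]
    exact hO h (Q ω)
  induction u with
  | zero =>
    -- With no stages left the invariant contradicts `entropyGain_le`, so the default output is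
    -- never reached.
    intro θ h hθ
    have := entropyGain_le (θ := θ) hp hp1 hq hq1 (by linarith) hpq
    simp only [Nat.cast_zero, zero_mul, add_zero] at hθ
    linarith
  | succ u ih =>
    intro θ h hθ
    rw [search]
    have hnext : ∀ ω h h', 2 * α < |O h (Q ω) - ∑ a, gibbs q θ a * restrictCoord g ω a| →
        (search hk hq hq1 g Q α t u
          (weightUpdate q α θ (restrictCoord g ω) (O h (Q ω)))).errorProb O h'
            (productMean (fun _ => p) g) ε ≤ u * ENNReal.ofReal (1 - ρ) ^ t := by
      intro ω h h' ht
      refine ih _ _ ?_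
      have := entropyGain_weightUpdate (p := p) (θ := θ) hq hq1 (f := restrictCoord g ω)
        (fun a => hg _) hα hα1 (hmean ω h) ht
      push_cast at hθ
      linarith
    by_cases hgood : |productMean (fun _ => gibbs q θ) g - productMean (fun _ => p) g| ≤ ε
    · refine (Algorithm.errorProb_searchStage_le_of_good hnext hgood t h).trans ?_
      push_cast
      gcongr
      exact le_self_add
    -- The threshold `3 * α` ensures that an answer off by `α` still shows a gap above `2 * α`.
    · have hlik := le_sum_sampleWeight hk hp hp1 (gibbs_nonneg (θ := θ) hq) (sum_gibbs hq hq1) hγ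
        hpq hg (β := 3 * α) (by linarith)
      have hpos : 0 < 2 * k * γ ^ (k - 1) := by positivity
      have hP : ρ ≤ ∑ ω : Fin k × (Fin k → ι),
          if ω ∈ {ω | 3 * α < |∑ y, (p y - gibbs q θ y) * restrictCoord g ω y|}
            then sampleWeight q (gibbs q θ) ω else 0 := by
        refine le_of_mul_le_mul_right ?_ hpos
        have hbad := not_le.1 hgood
        refine hρ.trans (le_trans ?_ (hlik.trans_eq (mul_comm _ _)))
        linarith
      refine (Algorithm.errorProb_searchStage_le_of_likely hnext ?_
        (samplePMF_compl_le hk hq hq1 (gibbs_nonneg (θ := θ) hq) (sum_gibbs hq hq1) _ hP)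
        t h).trans_eq ?_
      · intro ω hω h
        have h1 := hmean ω h
        simp only [Set.mem_ofPred_eq, sub_mul, Finset.sum_sub_distrib] at hω
        have h2 := abs_sub_le (∑ a, p a * restrictCoord g ω a) (O h (Q ω))
          (∑ a, gibbs q θ a * restrictCoord g ω a)
        rw [abs_sub_comm _ (O h (Q ω))] at h2
        linarith
      · push_cast
        ring

end Search

/-! ### Transfer between queries and cells -/

section Cells

variable {X : Type u} [MeasurableSpace X]

/-- The unary query that reads the cell of the sample. -/
def cellQuery {n : ℕ} {π : X → Fin n} (hπ : Measurable π) (f : Fin n → ℝ) (hf : ∀ a, |f a| ≤ 1) :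
    Query X 1 where
  toFun x := f (π (x 0))
  measurable := (measurable_of_finite f).comp (hπ.comp (measurable_pi_apply 0))
  mem_Icc _ := abs_le.1 (hf _)

theorem mean_cellQuery {n : ℕ} {π : X → Fin n} (hπ : Measurable π) (f : Fin n → ℝ)
    (hf : ∀ a, |f a| ≤ 1) (D : ProbabilityMeasure X) :
    (cellQuery hπ f hf).mean D = ∑ a, (D : Measure X).real (π ⁻¹' {a}) * f a := by
  refine (integral_comp_cell (k := 1) (D : Measure X) hπ fun y => f (y 0)).trans ?_
  rw [← Equiv.sum_comp (Equiv.funUnique (Fin 1) (Fin n)).symm]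
  simp

theorem sum_real_cell (μ : Measure X) [IsProbabilityMeasure μ] {n : ℕ} {π : X → Fin n}
    (hπ : Measurable π) : ∑ a, μ.real (π ⁻¹' {a}) = 1 := by
  rw [sum_measureReal_preimage_singleton _ fun a _ => hπ (measurableSet_singleton a)]
  simp

/-- The mean of a query under a distribution dominated by `γ * ν` is close to the mean of any grid
function that is close to the query in mean with respect to `ν`. -/
theorem abs_productMean_sub_mean_le {k : ℕ} (φ : Query X k)
    {D ν : ProbabilityMeasure X} {γ : ℝ} (hγ : 1 ≤ γ)
    (hD : ∀ E, MeasurableSet E → (D : Measure X).real E ≤ γ * (ν : Measure X).real E)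
    {n : ℕ} {π : X → Fin n} (hπ : Measurable π) {g : (Fin k → Fin n) → ℝ} {ε : ℝ}
    (hε : ∫ x, |φ.toFun x - g (π ∘ x)| ∂(Measure.pi fun _ : Fin k => (ν : Measure X)) ≤ ε) :
    |productMean (fun _ a => (D : Measure X).real (π ⁻¹' {a})) g - φ.mean D| ≤ γ ^ k * ε := by
  have hgm : Measurable fun x : Fin k → X => g (π ∘ x) :=
    IsGridFunction.measurable ⟨n, π, g, hπ, rfl⟩
  have hsub : ∀ μ : ProbabilityMeasure X, Integrable (fun x => φ.toFun x - g (π ∘ x))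
      (Measure.pi fun _ : Fin k => (μ : Measure X)) := by
    intro μ
    obtain ⟨M, hM⟩ := (Set.finite_range fun y => |g y|).bddAbove
    refine .of_bound (φ.measurable.sub hgm).aestronglyMeasurable (1 + M) (.of_forall fun x => ?_)
    refine (abs_sub _ _).trans (add_le_add (abs_le.2 (φ.mem_Icc x)) ?_)
    exact hM ⟨π ∘ x, rfl⟩
  have hg_int : Integrable (fun x => g (π ∘ x))
      (Measure.pi fun _ : Fin k => (D : Measure X)) := by
    obtain ⟨M, hM⟩ := (Set.finite_range fun y => |g y|).bddAbove
    exact .of_bound hgm.aestronglyMeasurable M (.of_forall fun x => hM ⟨π ∘ x, rfl⟩)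
  have hφ_int : Integrable φ.toFun (Measure.pi fun _ : Fin k => (D : Measure X)) :=
    .of_bound φ.measurable.aestronglyMeasurable 1 (.of_forall fun x => abs_le.2 (φ.mem_Icc x))
  have hγ0 : 0 ≤ γ := by linarith
  have hle : (D : Measure X) ≤ γ.toNNReal • (ν : Measure X) := by
    refine Measure.le_iff.2 fun E hE => ?_
    rw [Measure.smul_apply, ENNReal.smul_def, smul_eq_mul, ← ENNReal.ofReal,
      ← ofReal_measureReal (μ := (D : Measure X)), ← ofReal_measureReal (μ := (ν : Measure X)),
      ← ENNReal.ofReal_mul hγ0]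
    exact ENNReal.ofReal_le_ofReal (hD E hE)
  have hpi := pi_le_smul_pi (k := k) (Real.toNNReal_pos.2 (by linarith : 0 < γ)).ne' hle
  have hmean : productMean (fun _ a => (D : Measure X).real (π ⁻¹' {a})) g =
      ∫ x, g (π ∘ x) ∂(Measure.pi fun _ : Fin k => (D : Measure X)) :=
    (integral_comp_cell (D : Measure X) hπ g).symm
  rw [hmean, abs_sub_comm, Query.mean, ← integral_sub hφ_int hg_int]
  calc _ ≤ ∫ x, |φ.toFun x - g (π ∘ x)| ∂(Measure.pi fun _ : Fin k => (D : Measure X)) :=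
        abs_integral_le_integral_abs
    _ ≤ ∫ x, |φ.toFun x - g (π ∘ x)|
          ∂(γ.toNNReal ^ k • Measure.pi fun _ : Fin k => (ν : Measure X)) :=
        integral_mono_measure hpi (.of_forall fun x => abs_nonneg _)
          ((hsub ν).abs.smul_measure_nnreal)
    _ = γ ^ k * ∫ x, |φ.toFun x - g (π ∘ x)| ∂(Measure.pi fun _ : Fin k => (ν : Measure X)) := by
        rw [integral_smul_nnreal_measure, NNReal.smul_def, smul_eq_mul]
        simp [hγ0]
    _ ≤ _ := by gcongr

end Cells

/-! ### Choice of parameters and the query count -/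

section Parameters

/-- The number of stages of the search. -/
noncomputable def stageCount (γ τ : ℝ) (k : ℕ) : ℕ :=
  ⌊144 * (k / τ) ^ 2 * Real.log γ⌋₊ + 1

/-- The number of queries in each stage of the search. -/
noncomputable def stageLength (γ τ δ : ℝ) (k : ℕ) : ℕ :=
  ⌈Real.log (stageCount γ τ k / δ) * (5 * (k / τ) * γ ^ (k - 1))⌉₊

/-- With `α = τ / (6 * k)`, the constant `144` is `4 * 6 ^ 2`; the floor plus one makes the
inequality strict. -/
theorem log_lt_stageCount_mul {γ τ : ℝ} {k : ℕ} (hτ : 0 < τ) (hk : 0 < k) :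
    Real.log γ < stageCount γ τ k * ((τ / (6 * k)) ^ 2 / 4) := by
  have h := Nat.lt_floor_add_one (144 * (k / τ) ^ 2 * Real.log γ)
  have hk' : (0 : ℝ) < k := by exact_mod_cast hk
  have hpos : 0 < (τ / (6 * k)) ^ 2 / 4 := by positivity
  calc Real.log γ = 144 * (k / τ) ^ 2 * Real.log γ * ((τ / (6 * k)) ^ 2 / 4) := by
        field_simp
        ring
    _ < _ := by
        refine mul_lt_mul_of_pos_right ?_ hpos
        rw [stageCount]
        exact_mod_cast h

/-- With `R` the inverse success probability, `(1 - 1/R)^T ≤ exp (-T/R)`, and the stage length `T`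
makes this at most `δ` over the number of stages. -/
theorem stageCount_mul_pow_le {γ τ δ : ℝ} {k : ℕ} (hγ : 1 ≤ γ) (hτ : 0 < τ) (hτ1 : τ ≤ 1)
    (hk : 0 < k) (hδ : 0 < δ) :
    stageCount γ τ k * (1 - (5 * (k / τ) * γ ^ (k - 1))⁻¹) ^ stageLength γ τ δ k ≤ δ := by
  have hk' : (1 : ℝ) ≤ k := by exact_mod_cast hk
  have hK : 1 ≤ k / τ := by rw [le_div_iff₀ hτ]; linarith
  have hG : 1 ≤ γ ^ (k - 1) := one_le_pow₀ hγ
  have hR : 1 ≤ 5 * (k / τ) * γ ^ (k - 1) := one_le_mul_of_one_le_of_one_le (by linarith) hG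
  set R := 5 * (k / τ) * γ ^ (k - 1) with hRdef
  have hR0 : 0 < R := by linarith
  have hU : (0 : ℝ) < stageCount γ τ k := by rw [stageCount]; positivity
  have hT : Real.log (stageCount γ τ k / δ) ≤ R⁻¹ * stageLength γ τ δ k := by
    rw [le_inv_mul_iff₀ hR0, mul_comm]
    exact Nat.le_ceil _
  have h1 : (1 - R⁻¹) ^ stageLength γ τ δ k ≤ Real.exp (-(R⁻¹ * stageLength γ τ δ k)) := by
    calc (1 - R⁻¹) ^ stageLength γ τ δ k ≤ Real.exp (-R⁻¹) ^ stageLength γ τ δ k :=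
          pow_le_pow_left₀ (sub_nonneg.2 (inv_le_one_of_one_le₀ hR))
            (Real.one_sub_le_exp_neg _) _
      _ = _ := by rw [← Real.exp_nat_mul]; congr 1; ring
  calc _ ≤ stageCount γ τ k * Real.exp (-Real.log (stageCount γ τ k / δ)) := by
        refine mul_le_mul_of_nonneg_left (h1.trans ?_) hU.le
        exact Real.exp_le_exp.2 (neg_le_neg hT)
    _ = δ := by
        rw [Real.exp_neg, Real.exp_log (div_pos hU hδ)]
        field_simp

/-- With the abbreviations of the proof, there are `O(K ^ 2 * L)` stages of length `O(L * m * K *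
G)`. Arity at least two gives `γ ≤ γ ^ (k - 1)`, so that `log γ` is absorbed into `L`. -/
theorem stageCount_mul_stageLength_le {γ τ δ : ℝ} {k : ℕ} (hγ : 1 ≤ γ) (hτ : 0 < τ) (hτ1 : τ ≤ 1)
    (hk : 2 ≤ k) (hδ : 0 < δ) :
    (stageCount γ τ k * stageLength γ τ δ k : ℝ) ≤
      6000 * (γ ^ (k - 1) * (k : ℝ) ^ 3 / τ ^ 3 * max 1 (Real.log (1 / δ))) *
        Real.log (2 + γ ^ (k - 1) * (k : ℝ) ^ 3 / τ ^ 3) ^ 2 := by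
  have hk' : (1 : ℝ) ≤ k := by exact_mod_cast (by omega : 1 ≤ k)
  have hK : 1 ≤ k / τ := by rw [le_div_iff₀ hτ]; linarith
  have hG : 1 ≤ γ ^ (k - 1) := one_le_pow₀ hγ
  have hγG : γ ≤ γ ^ (k - 1) := le_self_pow₀ hγ (by omega)
  have hF : γ ^ (k - 1) * (k : ℝ) ^ 3 / τ ^ 3 = γ ^ (k - 1) * (k / τ) ^ 3 := by
    rw [div_pow]; ring
  have hm : 1 ≤ max 1 (Real.log (1 / δ)) := le_max_left _ _
  have hm' : Real.log (1 / δ) ≤ max 1 (Real.log (1 / δ)) := le_max_right _ _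
  rw [hF]
  simp only [stageLength]
  set m := max 1 (Real.log (1 / δ))
  set K := k / τ
  set G := γ ^ (k - 1)
  have hK3 : K ^ 2 ≤ K ^ 3 := pow_le_pow_right₀ hK (by norm_num)
  have hK31 : 1 ≤ K ^ 3 := one_le_pow₀ hK
  have hGF : G ≤ G * K ^ 3 := le_mul_of_one_le_right (by linarith) hK31
  have hKF : K ^ 2 ≤ G * K ^ 3 := hK3.trans (le_mul_of_one_le_left (by linarith) hG)
  set F := G * K ^ 3 with hFdef
  set L := Real.log (2 + F)
  have hL : 1 ≤ L := by
    rw [Real.le_log_iff_exp_le (by linarith)]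
    linarith [Real.exp_one_lt_d9]
  have hLF : L ≤ 2 + F := (Real.log_le_sub_one_of_pos (by linarith)).trans (by linarith)
  have hγL : Real.log γ ≤ L := Real.log_le_log (by linarith) (by linarith)
  have hU0 : (0 : ℝ) < stageCount γ τ k := by rw [stageCount]; positivity
  have hU : (stageCount γ τ k : ℝ) ≤ 145 * (K ^ 2 * L) := by
    have h1 : (⌊144 * K ^ 2 * Real.log γ⌋₊ : ℝ) ≤ 144 * K ^ 2 * Real.log γ :=
      Nat.floor_le (mul_nonneg (by positivity) (Real.log_nonneg hγ))
    have h2 : 144 * K ^ 2 * Real.log γ ≤ 144 * K ^ 2 * L := by gcongr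
    have h3 : 1 ≤ K ^ 2 * L := one_le_mul_of_one_le_of_one_le (one_le_pow₀ hK) hL
    rw [stageCount]
    push_cast
    linarith
  have hUlog : Real.log (stageCount γ τ k) ≤ 7 * L := by
    have h1 : (stageCount γ τ k : ℝ) ≤ 145 * ((2 + F) * (2 + F)) := by
      refine hU.trans ?_
      gcongr
      linarith
    have h145 : Real.log 145 ≤ 5 := by
      rw [Real.log_le_iff_le_exp (by norm_num)]
      have h := pow_le_pow_left₀ (by norm_num) Real.exp_one_gt_d9.le 5
      rw [← Real.exp_nat_mul] at h
      norm_num at h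
      linarith
    have h2 := Real.log_le_log hU0 h1
    rw [Real.log_mul (by norm_num) (by positivity), Real.log_mul (by positivity) (by positivity)]
      at h2
    linarith
  have hlog : Real.log (stageCount γ τ k / δ) ≤ 8 * (L * m) := by
    have h1 : L ≤ L * m := le_mul_of_one_le_right (by linarith) hm
    have h2 : m ≤ L * m := le_mul_of_one_le_left (by linarith) hL
    rw [div_eq_mul_one_div, Real.log_mul hU0.ne' (by positivity)]
    linarith
  have hKG : 1 ≤ K * G := one_le_mul_of_one_le_of_one_le hK hG
  have hT : (⌈Real.log (stageCount γ τ k / δ) * (5 * K * G)⌉₊ : ℝ) ≤ 41 * (L * m * (K * G)) := by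
    have h0 : 1 ≤ L * m * (K * G) :=
      one_le_mul_of_one_le_of_one_le (one_le_mul_of_one_le_of_one_le hL hm) hKG
    have h1 : Real.log (stageCount γ τ k / δ) * (5 * K * G) ≤ 40 * (L * m * (K * G)) := by
      calc _ ≤ 8 * (L * m) * (5 * K * G) := by gcongr
        _ = _ := by ring
    have h2 : (⌈Real.log (stageCount γ τ k / δ) * (5 * K * G)⌉₊ : ℝ) ≤
        ⌈40 * (L * m * (K * G))⌉₊ := by exact_mod_cast Nat.ceil_mono h1
    have h3 := Nat.ceil_lt_add_one (a := 40 * (L * m * (K * G))) (by linarith)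
    linarith
  calc _ ≤ 145 * (K ^ 2 * L) * (41 * (L * m * (K * G))) := by gcongr
    _ = 5945 * (F * m) * L ^ 2 := by rw [hFdef]; ring
    _ ≤ 6000 * (F * m) * L ^ 2 := by
        have : 0 ≤ F * m := mul_nonneg (by linarith) (by linarith)
        gcongr
        norm_num

end Parameters

/-! ### Assembling the algorithm -/

/-- The search on a fine enough grid estimates the mean of a query of any arity. -/
theorem exists_algorithm {X : Type u} [MeasurableSpace X] {𝒟 : Set (ProbabilityMeasure X)}
    {γ τ δ : ℝ} {k : ℕ} (hγ : 1 ≤ γ) (hτ : 0 < τ) (hτ1 : τ ≤ 1) (hk : 0 < k)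
    (h𝒟 : IsFlat γ 𝒟) (hδ : 0 < δ) (φ : Query X k) :
    ∃ A : Algorithm X 1, A.AsksAtMost (stageCount γ τ k * stageLength γ τ δ k) ∧
      ∀ D ∈ 𝒟, ∀ O : Oracle X 1, IsSTAT D (τ / (6 * k)) O → A.Estimates O (φ.mean D) τ δ := by
  obtain ⟨ν, hν⟩ := h𝒟
  have hk' : (1 : ℝ) ≤ k := by exact_mod_cast hk
  have hγ0 : 0 < γ := by linarith
  -- Passing from `ν` to `D` multiplies the error by `γ ^ k`, which leaves `τ / 10`.
  obtain ⟨n, π, g, hπ, hg, hφg⟩ := IsGridFunction.exists_integral_abs_sub_le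
    (Measure.pi fun _ : Fin k => (ν : Measure X)) φ
    (ε := τ / 10 / γ ^ k) (by positivity)
  obtain ⟨x₀⟩ : Nonempty X := nonempty_of_isProbabilityMeasure (ν : Measure X)
  have : Nonempty (Fin k × (Fin k → Fin n)) := ⟨(⟨0, hk⟩, fun _ => π x₀)⟩
  have hq : ∀ a, 0 ≤ (ν : Measure X).real (π ⁻¹' {a}) := fun a => measureReal_nonneg
  let Q : Fin k × (Fin k → Fin n) → Query X 1 := fun ω =>
    cellQuery hπ (restrictCoord g ω) fun a => hg _
  refine ⟨search hk hq (sum_real_cell _ hπ) g Q (τ / (6 * k)) (stageLength γ τ δ k)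
    (stageCount γ τ k) 0, asksAtMost_search _ _ _ le_rfl, fun D hD O hO => ?_⟩
  have hclose := abs_productMean_sub_mean_le φ hγ (hν D hD) hπ hφg
  rw [mul_div_cancel₀ _ (by positivity : γ ^ k ≠ 0)] at hclose
  apply Algorithm.estimates_of_errorProb_le hδ.le
  -- The search gets the remaining `9 * τ / 10`. Since `3 * k * α = τ / 2`, there is `2 * τ / 5`
  -- left, which divided by `2 * k * γ ^ (k - 1)` is `ρ`.
  have herr := errorProb_search_le (hk := hk) (hq := hq) (hq1 := sum_real_cell _ hπ) (Q := Q)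
    (p := fun a => (D : Measure X).real (π ⁻¹' {a})) (g := g) (t := stageLength γ τ δ k) hO
    (fun ω => mean_cellQuery hπ _ _ D) (fun a => measureReal_nonneg) (sum_real_cell _ hπ) hγ
    (fun a => hν D hD _ (hπ (measurableSet_singleton a))) hg (by positivity)
    (by rw [div_le_one (by positivity)]; linarith) (ε := 9 * τ / 10)
    (ρ := (5 * (k / τ) * γ ^ (k - 1))⁻¹) (le_of_eq (by field_simp; norm_num))
    (stageCount γ τ k) 0 []
    (by
      rw [entropyGain_zero (sum_real_cell _ hπ), zero_add]
      exact log_lt_stageCount_mul hτ hk)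
  have hR : 0 ≤ 1 - (5 * (k / τ) * γ ^ (k - 1))⁻¹ := by
    have hK : 1 ≤ k / τ := by rw [le_div_iff₀ hτ]; linarith
    exact sub_nonneg.2 (inv_le_one_of_one_le₀
      (one_le_mul_of_one_le_of_one_le (by linarith) (one_le_pow₀ hγ)))
  refine (measure_mono fun r hr => ?_).trans (herr.trans ?_)
  · change τ < |r - φ.mean D| at hr
    change 9 * τ / 10 < |r - _|
    have := abs_sub_le r (productMean (fun _ a => (D : Measure X).real (π ⁻¹' {a})) g) (φ.mean D)
    linarith
  · rw [← ENNReal.ofReal_pow hR, ← ENNReal.ofReal_natCast, ← ENNReal.ofReal_mul (by positivity)]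
    exact ENNReal.ofReal_le_ofReal (stageCount_mul_pow_le hγ hτ hτ1 hk hδ)

theorem Query.abs_mean_le_one {X : Type u} [MeasurableSpace X] {k : ℕ} (φ : Query X k)
    (D : ProbabilityMeasure X) : |φ.mean D| ≤ 1 := by
  simpa [Query.mean] using norm_integral_le_of_norm_le_const
    (μ := Measure.pi fun _ : Fin k => (D : Measure X)) (f := φ.toFun) (C := 1)
    (.of_forall fun x => abs_le.2 (φ.mem_Icc x))

/-- A query of arity one can be asked directly. -/
theorem estimates_ask {X : Type u} [MeasurableSpace X] (φ : Query X 1) {τ τ' δ : ℝ}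
    {D : ProbabilityMeasure X} {O : Oracle X 1} (hO : IsSTAT D τ' O) (hτ : τ' ≤ τ) (hδ : 0 ≤ δ) :
    (Algorithm.ask φ .output).Estimates O (φ.mean D) τ δ := by
  apply Algorithm.estimates_of_errorProb_le hδ
  rw [Algorithm.errorProb_ask, Algorithm.errorProb_output ((hO _ _).trans hτ)]
  exact zero_le

end SQ

theorem theorem2 :
    ∃ (C : ℝ) (c : ℕ), 0 < C ∧
      ∀ (X : Type u) [MeasurableSpace X] (𝒟 : Set (ProbabilityMeasure X)) (γ τ : ℝ) (k : ℕ),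
        1 ≤ γ → 0 < τ → 0 < k → SQ.IsFlat γ 𝒟 →
        ∃ A : ℝ → SQ.Query X k → SQ.Algorithm X 1,
          ∀ (δ : ℝ) (φ : SQ.Query X k), 0 < δ →
            (∃ q : ℕ, (A δ φ).AsksAtMost q ∧
              (q : ℝ) ≤ C * (γ ^ (k - 1) * (k : ℝ) ^ 3 / τ ^ 3 * max 1 (Real.log (1 / δ))) *
                Real.log (2 + γ ^ (k - 1) * (k : ℝ) ^ 3 / τ ^ 3) ^ c) ∧
            ∀ D ∈ 𝒟, ∀ O : SQ.Oracle X 1, SQ.IsSTAT D (τ / (6 * k)) O →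
              (A δ φ).Estimates O (φ.mean D) τ δ := by
  refine ⟨6000, 2, by norm_num, fun X _ 𝒟 γ τ k hγ hτ hk h𝒟 => ?_⟩
  suffices h : ∀ (δ : ℝ) (φ : SQ.Query X k), ∃ A : SQ.Algorithm X 1, 0 < δ →
      (∃ q : ℕ, A.AsksAtMost q ∧
        (q : ℝ) ≤ 6000 * (γ ^ (k - 1) * (k : ℝ) ^ 3 / τ ^ 3 * max 1 (Real.log (1 / δ))) *
          Real.log (2 + γ ^ (k - 1) * (k : ℝ) ^ 3 / τ ^ 3) ^ 2) ∧
      ∀ D ∈ 𝒟, ∀ O : SQ.Oracle X 1, SQ.IsSTAT D (τ / (6 * k)) O →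
        A.Estimates O (φ.mean D) τ δ by
    choose A hA using h
    exact ⟨A, hA⟩
  intro δ φ
  by_cases hδ : 0 < δ
  swap
  · exact ⟨.output 0, fun h => absurd h hδ⟩
  -- For `τ > 1` the output `0` is accurate, as means lie in `[-1, 1]`.
  rcases lt_or_ge 1 τ with hτ1 | hτ1
  · refine ⟨.output 0, fun _ => ⟨⟨0, trivial, ?_⟩, fun D _ O _ => ?_⟩⟩
    · rw [Nat.cast_zero]
      positivity
    · apply SQ.Algorithm.estimates_of_errorProb_le hδ.le
      rw [SQ.Algorithm.errorProb_output]
      · exact zero_le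
      · rw [zero_sub, abs_neg]
        exact (φ.abs_mean_le_one D).trans hτ1.le
  -- For `k = 1` the bound does not involve `γ`, so the `log γ` of the search is not affordable; one
  -- direct query suffices.
  rcases (by omega : k = 1 ∨ 2 ≤ k) with rfl | hk2
  · refine ⟨.ask φ .output, fun _ => ⟨⟨1, fun _ => trivial, ?_⟩, fun D _ O hO => ?_⟩⟩
    · have hF : 1 ≤ 1 / τ ^ 3 := by
        rw [le_div_iff₀ (by positivity), one_mul]
        exact pow_le_one₀ hτ.le hτ1
      have hL : 1 ≤ Real.log (2 + 1 / τ ^ 3) := by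
        rw [Real.le_log_iff_exp_le (by positivity)]
        linarith [Real.exp_one_lt_d9]
      have hFm : 1 ≤ 1 / τ ^ 3 * max 1 (Real.log (1 / δ)) :=
        one_le_mul_of_one_le_of_one_le hF (le_max_left _ _)
      simp only [Nat.sub_self, pow_zero, Nat.cast_one, one_pow, mul_one]
      exact one_le_mul_of_one_le_of_one_le (by linarith) (one_le_pow₀ hL)
    · exact SQ.estimates_ask φ hO (div_le_self hτ.le (by norm_num)) hδ.le
  · obtain ⟨A, hq, hA⟩ := SQ.exists_algorithm hγ hτ hτ1 hk h𝒟 hδ φ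
    refine ⟨A, fun _ => ⟨⟨_, hq, ?_⟩, hA⟩⟩
    push_cast
    exact SQ.stageCount_mul_stageLength_le hγ hτ hτ1 hk2 hδ
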